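/- Let $K$ be a compact Hausdorff space, let $\varphi : K \to K$ be a homeomorphism of $K$ onto its image with $\varphi(K) \subsetneqq K$, and let $w \in C(K)$, where $C(K)$ denotes the Banach space of all complex-valued continuous functions on $K$ with the supremum norm. Let $T$ be the weighted composition operator on $C(K)$ defined by $$(Tf)(k) = w(k) f(\varphi(k)), \qquad f \in C(K),\ k \in K.$$ Put $$L = \bigcap_{n=0}^\infty \varphi^n(K), \qquad M = K \setminus \mathrm{Int}_K L .$$ The closed sets $L$ and $M$ satisfy $\varphi(L) \subseteq L$ and $\varphi(M) \subseteq M$, so the same formula defines bounded operators on $C(L)$ and on $C(M)$. Let $\sigma(T)$ be the spectrum of $T$ on $C(K)$, let $\sigma(T, C(L))$ and $\sigma(T, C(M))$ be the spectra of the operators on $C(L)$ and $C(M)$, and let $\rho(T, C(M))$ be the spectral radius of the operator on $C(M)$. Then: (I) $\sigma(T, C(M))$ is either the closed disk $\{\lambda \in \mathbb{C} : |\lambda| \le \rho(T, C(M))\}$ or the singleton $\{0\}$; (II) $\sigma(T) = \sigma(T, C(M)) \cup \sigma(T, C(L))$. -/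

import Mathlib

noncomputable section

namespace WeightedComposition

/-- The weighted composition operator `(T f)(x) = w(x) f(φ(x))` on `C(X)`. -/
def op {X : Type*} [TopologicalSpace X] [CompactSpace X] (w : C(X, ℂ)) (φ : C(X, X)) :
    C(X, ℂ) →L[ℂ] C(X, ℂ) :=
  LinearMap.mkContinuous
    { toFun := fun f => w * f.comp φ
      map_add' := fun f g => by ext x; simp [mul_add]
      map_smul' := fun c f => by ext x; simp }
    ‖w‖
    (fun f => by
      refine (norm_mul_le _ _).trans (mul_le_mul_of_nonneg_left ?_ (norm_nonneg w))
      exact (ContinuousMap.norm_le _ (norm_nonneg f)).2 fun x => f.norm_coe_le_norm (φ x))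

theorem op_apply {X : Type*} [TopologicalSpace X] [CompactSpace X] (w : C(X, ℂ)) (φ : C(X, X))
    (f : C(X, ℂ)) (x : X) : op w φ f x = w x * f (φ x) := rfl

/-- The operator given by the same formula on `C(S)`, for a compact `φ`-invariant subset `S`. -/
def opOn {X : Type*} [TopologicalSpace X] (w : C(X, ℂ)) (φ : C(X, X)) (S : Set X) [CompactSpace S]
    (hS : Set.MapsTo φ S S) : C(S, ℂ) →L[ℂ] C(S, ℂ) :=
  op (w.restrict S) ⟨hS.restrict φ S S, φ.continuous.restrict hS⟩

variable {K : Type*} [TopologicalSpace K]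

/-- `L = ⋂_{n ≥ 0} φⁿ(K)`. -/
def L (φ : C(K, K)) : Set K := ⋂ n : ℕ, Set.range (φ^[n])

/-- `M = K \ Int L`. -/
def M (φ : C(K, K)) : Set K := (interior (L φ))ᶜ

theorem mapsTo_L (φ : C(K, K)) : Set.MapsTo φ (L φ) (L φ) := by
  intro x hx
  refine Set.mem_iInter.2 fun n => ?_
  obtain ⟨y, rfl⟩ := Set.mem_iInter.1 hx n
  exact ⟨φ y, by rw [← Function.iterate_succ_apply, Function.iterate_succ_apply']⟩

theorem mapsTo_M (φ : C(K, K)) (hφ : Function.Injective φ) : Set.MapsTo φ (M φ) (M φ) := by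
  intro x hx hx'
  refine hx (interior_maximal ?_ (isOpen_interior.preimage φ.continuous) hx')
  intro z hz
  refine Set.mem_iInter.2 fun n => ?_
  obtain ⟨y, hy⟩ := Set.mem_iInter.1 (interior_subset hz) (n + 1)
  rw [Function.iterate_succ_apply'] at hy
  exact ⟨y, hφ hy⟩

instance compactSpace_L [CompactSpace K] [T2Space K] (φ : C(K, K)) : CompactSpace (L φ) :=
  isCompact_iff_compactSpace.1
    (isClosed_iInter fun n => (isCompact_range (φ.continuous.iterate n)).isClosed).isCompact

instance compactSpace_M [CompactSpace K] (φ : C(K, K)) : CompactSpace (M φ) :=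
  isCompact_iff_compactSpace.1 isOpen_interior.isClosed_compl.isCompact

end WeightedComposition

end

namespace WeightedComposition

open Filter Topology

/-! The resolvent controls the growth of the cocycle `wₙ` off `L`. If `μ ≠ 0` is not in the
spectrum, a bump function at `φⁿ(x)`, `x ∉ L`, is killed by a high power of the operator, so the
resolvent acts on it as a finite geometric sum, and evaluating at `x` isolates `wₙ(x)`. Hence
`‖wₙ(x)‖ ≤ C‖μ‖ⁿ` (`exists_cocycle_bound_compl_L`). The resolvent set is open, so `μ` may be
replaced by some `ν` of smaller modulus; by continuity the bound passes to `M`, the closure of the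
complement of `L`.

Such a bound excludes from the spectrum on `M` every scalar of modulus at least `‖μ‖`. As `0` is in
that spectrum, it is a closed disk, possibly of radius zero. The bound also forces bounded solutions
of the homogeneous equation along orbits in `M` to vanish, so solutions of the resolvent equation on
`L` and on `M` agree on the overlap and glue; this gives the union formula. -/

/-- The cocycle `wₙ(x) = ∏_{k < n} w(φᵏ(x))` of a weight along the orbits of a self-map. -/
def cocycle {X : Type*} (w : X → ℂ) (φ : X → X) (n : ℕ) (x : X) : ℂ :=
  ∏ k ∈ Finset.range n, w (φ^[k] x)

theorem cocycle_succ {X : Type*} (w : X → ℂ) (φ : X → X) (n : ℕ) (x : X) :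
    cocycle w φ (n + 1) x = cocycle w φ n x * w (φ^[n] x) :=
  Finset.prod_range_succ _ _

theorem continuous_cocycle {X : Type*} [TopologicalSpace X] (w : C(X, ℂ)) (φ : C(X, X)) (n : ℕ) :
    Continuous (cocycle w φ n) :=
  continuous_finsetProd _ fun k _ => w.continuous.comp (φ.continuous.iterate k)

theorem op_pow_apply {X : Type*} [TopologicalSpace X] [CompactSpace X] (w : C(X, ℂ)) (φ : C(X, X))
    (n : ℕ) (f : C(X, ℂ)) (x : X) : (op w φ ^ n) f x = cocycle w φ n x * f (φ^[n] x) := by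
  induction n generalizing f with
  | zero => simp [cocycle]
  | succ n ih =>
    rw [pow_succ, mul_apply_eq_comp, ih, op_apply, cocycle_succ,
      Function.iterate_succ_apply', mul_assoc]

theorem opOn_apply {X : Type*} [TopologicalSpace X] (w : C(X, ℂ)) (φ : C(X, X)) (S : Set X)
    [CompactSpace S] (hS : Set.MapsTo φ S S) (f : C(S, ℂ)) (x : S) :
    opOn w φ S hS f x = w x * f ⟨φ x, hS x.2⟩ := rfl

theorem iterate_restrict_coe {X : Type*} {φ : X → X} {S : Set X} (hS : Set.MapsTo φ S S) (n : ℕ)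
    (x : S) : ((hS.restrict φ S S)^[n] x : X) = φ^[n] x := by
  rw [hS.iterate_restrict, Set.MapsTo.val_restrict_apply]

theorem cocycle_restrict {X : Type*} (w : X → ℂ) {φ : X → X} {S : Set X} (hS : Set.MapsTo φ S S)
    (n : ℕ) (x : S) :
    cocycle (fun y : S => w y) (hS.restrict φ S S) n x = cocycle w φ n x := by
  simp only [cocycle, iterate_restrict_coe]

theorem exists_bump {X : Type*} [TopologicalSpace X] [CompactSpace X] [T2Space X] {S : Set X}
    (hS : IsClosed S) {x : X} (hx : x ∉ S) :
    ∃ g : C(X, ℂ), (∀ y ∈ S, g y = 0) ∧ g x = 1 ∧ ‖g‖ ≤ 1 := by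
  obtain ⟨f, h0, h1, hf⟩ := exists_continuous_zero_one_of_isClosed hS isClosed_singleton
    (Set.disjoint_singleton_right.2 hx)
  refine ⟨⟨fun y => (f y : ℂ), by fun_prop⟩, fun y hy => ?_, ?_, ?_⟩
  · simpa using h0 hy
  · simpa using h1 (Set.mem_singleton x)
  · refine (ContinuousMap.norm_le _ zero_le_one).2 fun y => ?_
    simpa [abs_of_nonneg (hf y).1] using (hf y).2

/-! ### Orbits off `L` and the growth of the cocycle -/

theorem antitone_range_iterate {X : Type*} (φ : X → X) :
    Antitone fun n : ℕ => Set.range φ^[n] := by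
  refine antitone_nat_of_succ_le fun n => ?_
  rintro _ ⟨y, rfl⟩
  exact ⟨φ y, (Function.iterate_succ_apply φ n y).symm⟩

/-- A point outside `⋂ φⁿ(X)` has pairwise distinct iterates. -/
theorem injective_iterate_of_notMem_L {X : Type*} [TopologicalSpace X] {φ : C(X, X)}
    (hφ : Function.Injective φ) {x : X} (hx : x ∉ L φ) :
    Function.Injective fun n : ℕ => φ^[n] x := by
  have key : ∀ k p : ℕ, φ^[k] x = φ^[k + (p + 1)] x → False := by
    intro k p h
    rw [Function.iterate_add_apply] at h
    have hper : φ^[p + 1] x = x := ((hφ.iterate k) h).symm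
    -- A point of period `p + 1` is its own image under `φ^[(p + 1) * n]`, hence lies in every
    -- range.
    refine hx (Set.mem_iInter.2 fun n => ?_)
    refine antitone_range_iterate φ (Nat.le_mul_of_pos_left n p.succ_pos) ⟨x, ?_⟩
    rw [Function.iterate_mul]
    exact Function.iterate_fixed hper n
  intro m n h
  rcases lt_trichotomy m n with hmn | hmn | hmn
  · obtain ⟨p, rfl⟩ := Nat.exists_eq_add_of_lt hmn
    exact (key m p h).elim
  · exact hmn
  · obtain ⟨p, rfl⟩ := Nat.exists_eq_add_of_lt hmn
    exact (key n p h.symm).elim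

/-- Off `L`, the cocycle grows at most like `|μ|ⁿ` for each `μ` in the resolvent set. -/
theorem exists_cocycle_bound_compl_L {X : Type*} [TopologicalSpace X] [CompactSpace X] [T2Space X]
    {φ : C(X, X)} (hφ : Function.Injective φ) (w : C(X, ℂ)) {μ : ℂ} (hμ : μ ≠ 0)
    (h : μ ∉ spectrum ℂ (op w φ)) :
    ∃ C : ℝ, 0 ≤ C ∧ ∀ x ∉ L φ, ∀ n, ‖cocycle w φ n x‖ ≤ C * ‖μ‖ ^ n := by
  obtain ⟨u, hu⟩ := spectrum.notMem_iff.1 h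
  set R : C(X, ℂ) →L[ℂ] C(X, ℂ) := ((u⁻¹ : (C(X, ℂ) →L[ℂ] C(X, ℂ))ˣ) : C(X, ℂ) →L[ℂ] C(X, ℂ))
  -- The constant must not depend on the depth `m` at which `x` leaves the ranges; the factor `‖μ‖ ^
  -- (m - 1)` cancels at the end.
  refine ⟨‖R‖ * ‖μ‖, by positivity, fun x hx n => ?_⟩
  obtain ⟨m, hm⟩ : ∃ m : ℕ, x ∉ Set.range φ^[m] := by simpa [L] using hx
  have hm0 : 0 < m := Nat.pos_of_ne_zero fun h0 => hm (by simp [h0])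
  set N := n + m with hN
  have hnN : φ^[n] x ∉ Set.range φ^[N] := by
    rintro ⟨y, hy⟩
    rw [hN, Function.iterate_add_apply] at hy
    exact hm ⟨y, hφ.iterate n hy⟩
  have hinj := injective_iterate_of_notMem_L hφ hx
  set F : Set X := (fun k : ℕ => φ^[k] x) '' ((Finset.range N).erase n)
  have hF : IsClosed F := ((Finset.finite_toSet _).image _).isClosed
  have hnF : φ^[n] x ∉ F := by
    rintro ⟨k, hk, hkn⟩
    exact (Finset.mem_erase.1 (Finset.mem_coe.1 hk)).1 (hinj hkn)
  -- Vanishing on the range of `φ^[N]` gives `T ^ N g = 0`; vanishing at the other orbit points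
  -- leaves one term of the geometric sum at `x`.
  obtain ⟨g, hg0, hg1, hg⟩ := exists_bump
    (((isCompact_range (φ.continuous.iterate N)).isClosed).union hF)
    (x := φ^[n] x) (by rintro (h | h); exacts [hnN h, hnF h])
  have hTN : (op w φ ^ N) g = 0 := by
    ext y
    rw [op_pow_apply, hg0 _ (Or.inl ⟨y, rfl⟩)]
    simp
  set G := (∑ i ∈ Finset.range N,
    algebraMap ℂ (C(X, ℂ) →L[ℂ] C(X, ℂ)) μ ^ i * op w φ ^ (N - 1 - i)) g with hG
  have hGR : G = μ ^ N • R g := by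
    have h1 := congrArg (fun A : C(X, ℂ) →L[ℂ] C(X, ℂ) => A g)
      (Commute.mul_geom_sum₂ (Algebra.commutes μ (op w φ)) N)
    rw [← hu] at h1
    simp only [mul_apply_eq_comp, _root_.sub_apply, hTN, sub_zero,
      ← map_pow, ContinuousLinearMap.algebraMap_apply] at h1
    have h2 := congrArg R h1
    rw [← mul_apply_eq_comp, Units.inv_mul, map_smul] at h2
    rw [← h2, hG]
    simp [map_pow]
  have hGx : G x = μ ^ (m - 1) * cocycle w φ n x := by
    rw [hG, _root_.sum_apply, ContinuousMap.sum_apply,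
      Finset.sum_eq_single (m - 1)]
    · have : N - 1 - (m - 1) = n := by omega
      rw [this, ← map_pow, mul_apply_eq_comp, ContinuousLinearMap.algebraMap_apply,
        ContinuousMap.smul_apply, op_pow_apply, hg1, mul_one, smul_eq_mul]
    · intro i hi him
      have hi' := Finset.mem_range.1 hi
      rw [← map_pow, mul_apply_eq_comp, ContinuousLinearMap.algebraMap_apply,
        ContinuousMap.smul_apply, op_pow_apply, hg0 _ (Or.inr ⟨N - 1 - i, ?_, rfl⟩)]
      · simp
      · simp only [Finset.coe_erase, Set.mem_sdiff, Finset.mem_coe, Finset.mem_range,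
          Set.mem_singleton_iff]
        omega
    · intro hnot
      exact absurd (Finset.mem_range.2 (by omega)) hnot
  have hpos : 0 < ‖μ‖ := norm_pos_iff.2 hμ
  have hle : ‖μ‖ ^ (m - 1) * ‖cocycle w φ n x‖ ≤ ‖μ‖ ^ (m - 1) * (‖R‖ * ‖μ‖ * ‖μ‖ ^ n) :=
    calc ‖μ‖ ^ (m - 1) * ‖cocycle w φ n x‖ = ‖G x‖ := by rw [hGx, norm_mul, norm_pow]
      _ ≤ ‖G‖ := G.norm_coe_le_norm x
      _ = ‖μ‖ ^ N * ‖R g‖ := by rw [hGR, norm_smul, norm_pow]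
      _ ≤ ‖μ‖ ^ N * ‖R‖ := by
        gcongr
        exact (R.le_opNorm g).trans (mul_le_of_le_one_right (norm_nonneg R) hg)
      _ = ‖μ‖ ^ (m - 1) * (‖R‖ * ‖μ‖ * ‖μ‖ ^ n) := by
        have : N = (m - 1) + 1 + n := by omega
        rw [this, pow_add, pow_succ]
        ring
  exact le_of_mul_le_mul_left hle (pow_pos hpos _)

/-! ### Spectral and topological tools -/

/-- The resolvent set of an operator contains, with each nonzero scalar, a nonzero one of smaller modulus. -/
theorem exists_notMem_spectrum_norm_lt {E : Type*} [NormedAddCommGroup E]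
    [NormedSpace ℂ E] [CompleteSpace E] {T : E →L[ℂ] E} {μ : ℂ} (hμ : μ ≠ 0)
    (h : μ ∉ spectrum ℂ T) : ∃ ν : ℂ, ν ≠ 0 ∧ ‖ν‖ < ‖μ‖ ∧ ν ∉ spectrum ℂ T := by
  have hcl : Tendsto (fun t : ℝ => (t : ℂ) * μ) (𝓝[<] 1) (𝓝 μ) := by
    have : Continuous fun t : ℝ => (t : ℂ) * μ := by fun_prop
    simpa using (this.tendsto 1).mono_left nhdsWithin_le_nhds
  have hev := hcl.eventually ((spectrum.isClosed T).isOpen_compl.mem_nhds h)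
  obtain ⟨t, ht, ht0, ht1⟩ := (hev.and (Ioo_mem_nhdsLT (zero_lt_one' ℝ))).exists
  refine ⟨t * μ, mul_ne_zero (by exact_mod_cast ht0.ne') hμ, ?_, ht⟩
  rw [norm_mul, Complex.norm_real, Real.norm_of_nonneg ht0.le]
  exact mul_lt_of_lt_one_left (norm_pos_iff.2 hμ) ht1

theorem norm_pow_le_of_mem_spectrum {E : Type*} [NormedAddCommGroup E] [NormedSpace ℂ E]
    [CompleteSpace E] [Nontrivial E] {T : E →L[ℂ] E} {μ : ℂ} (h : μ ∈ spectrum ℂ T) (n : ℕ) :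
    ‖μ‖ ^ n ≤ ‖T ^ n‖ :=
  norm_pow μ n ▸ spectrum.norm_le_norm_of_mem (spectrum.pow_mem_pow T n h)

/-- A bump at a point outside the range of `φ`, vanishing on that range, lies in the kernel. -/
theorem zero_mem_spectrum_op {X : Type*} [TopologicalSpace X] [CompactSpace X] [T2Space X]
    {φ : C(X, X)} (w : C(X, ℂ)) {x : X} (hx : x ∉ Set.range φ) : 0 ∈ spectrum ℂ (op w φ) := by
  by_contra h
  obtain ⟨g, hg0, hg1, -⟩ := exists_bump (isCompact_range φ.continuous).isClosed hx
  have hinj := (ContinuousLinearMap.isUnit_iff_bijective.1 (spectrum.notMem_iff.1 h)).1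
  have : g = 0 := hinj (by
    ext y
    simp [op_apply, hg0 (φ y) ⟨y, rfl⟩])
  simp [this] at hg1

theorem exists_glue {X : Type*} [TopologicalSpace X] {A B : Set X} (hA : IsClosed A)
    (hB : IsClosed B) (hAB : A ∪ B = Set.univ) (f : C(A, ℂ)) (g : C(B, ℂ))
    (hfg : ∀ x (hx : x ∈ A) (hx' : x ∈ B), f ⟨x, hx⟩ = g ⟨x, hx'⟩) :
    ∃ h : C(X, ℂ), (∀ x : A, h x = f x) ∧ ∀ x : B, h x = g x := by
  classical
  have hmem : ∀ x, x ∉ A → x ∈ B := fun x hx =>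
    ((Set.mem_union _ _ _).1 (hAB ▸ Set.mem_univ x)).resolve_left hx
  let h : X → ℂ := fun x => if hx : x ∈ A then f ⟨x, hx⟩ else g ⟨x, hmem x hx⟩
  have h1 : ∀ x : A, h x = f x := fun x => by simp [h]
  have h2 : ∀ x : B, h x = g x := fun x => by
    by_cases hx : (x : X) ∈ A
    · simpa [h, hx] using hfg x hx x.2
    · simp [h, hx]
  have hc : Continuous h := by
    rw [← continuousOn_univ, ← hAB]
    refine ContinuousOn.union_of_isClosed ?_ ?_ hA hB <;>
      rw [continuousOn_iff_continuous_domRestrict]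
    · exact f.continuous.congr fun x => (h1 x).symm
    · exact g.continuous.congr fun x => (h2 x).symm
  exact ⟨⟨h, hc⟩, h1, h2⟩

variable {K : Type*} [TopologicalSpace K]

/-! ### Cocycle bounds on `M` and the spectrum there -/

/-- The cocycle is `O(rⁿ)` uniformly on `M`. -/
def CocycleBoundOnM (w : C(K, ℂ)) (φ : C(K, K)) (r : ℝ) : Prop :=
  ∃ C : ℝ, 0 ≤ C ∧ ∀ x ∈ M φ, ∀ n, ‖cocycle w φ n x‖ ≤ C * r ^ n

theorem M_eq_closure (φ : C(K, K)) : M φ = closure (L φ)ᶜ := closure_compl.symm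

theorem isClosed_M (φ : C(K, K)) : IsClosed (M φ) := isOpen_interior.isClosed_compl

theorem L_union_M (φ : C(K, K)) : L φ ∪ M φ = Set.univ :=
  Set.eq_univ_of_forall fun _ => or_iff_not_imp_left.2 fun hx hx' => hx (interior_subset hx')

theorem notMem_L_of_notMem_range {φ : C(K, K)} {x : K} (hx : x ∉ Set.range φ) : x ∉ L φ :=
  fun h => hx (by simpa using Set.mem_iInter.1 h 1)

theorem cocycleBoundOnM_of_compl_L {w : C(K, ℂ)} {φ : C(K, K)} {r : ℝ} {C : ℝ} (hC : 0 ≤ C)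
    (h : ∀ x ∉ L φ, ∀ n, ‖cocycle w φ n x‖ ≤ C * r ^ n) : CocycleBoundOnM w φ r := by
  refine ⟨C, hC, fun x hx n => ?_⟩
  rw [M_eq_closure] at hx
  exact closure_minimal (fun y hy => h y hy n)
    (isClosed_le (continuous_cocycle w φ n).norm continuous_const) hx

/-- A bounded solution of `w · (d ∘ φ) = μ d` along an orbit in `M` vanishes for large `μ`. -/
theorem CocycleBoundOnM.eq_zero {w : C(K, ℂ)} {φ : C(K, K)} {r : ℝ} (h : CocycleBoundOnM w φ r)
    (hr : 0 ≤ r) {μ : ℂ} (hμ : r < ‖μ‖) {x : K} (hx : x ∈ M φ) {d : ℕ → ℂ} {D : ℝ}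
    (hd : ∀ k, w (φ^[k] x) * d (k + 1) = μ * d k) (hD : ∀ k, ‖d k‖ ≤ D) : d 0 = 0 := by
  obtain ⟨C, hC, hb⟩ := h
  have hpos : 0 < ‖μ‖ := hr.trans_lt hμ
  have hrec : ∀ n, cocycle w φ n x * d n = μ ^ n * d 0 := by
    intro n
    induction n with
    | zero => simp [cocycle]
    | succ n ih => rw [cocycle_succ, mul_assoc, hd, mul_left_comm, ih, pow_succ']; ring
  have hle : ∀ n : ℕ, ‖d 0‖ ≤ C * D * (r / ‖μ‖) ^ n := by
    intro n
    have h1 : ‖μ‖ ^ n * ‖d 0‖ ≤ C * r ^ n * D := by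
      rw [← norm_pow, ← norm_mul, ← hrec, norm_mul]
      exact mul_le_mul (hb x hx n) (hD n) (norm_nonneg _) (by positivity)
    rw [div_pow, mul_div_assoc', le_div_iff₀ (pow_pos hpos n)]
    linarith
  have hlim : Tendsto (fun n : ℕ => C * D * (r / ‖μ‖) ^ n) atTop (𝓝 0) := by
    simpa using (tendsto_pow_atTop_nhds_zero_of_lt_one (by positivity)
      ((div_lt_one hpos).2 hμ)).const_mul (C * D)
  exact norm_le_zero_iff.1 (ge_of_tendsto' hlim hle)

variable [CompactSpace K]

theorem CocycleBoundOnM.notMem_spectrum {w : C(K, ℂ)} {φ : C(K, K)} (hφ : Function.Injective φ)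
    {r : ℝ} (h : CocycleBoundOnM w φ r) (hr : 0 ≤ r) {μ : ℂ} (hμ : r < ‖μ‖) [Nonempty (M φ)] :
    μ ∉ spectrum ℂ (opOn w φ (M φ) (mapsTo_M φ hφ)) := by
  obtain ⟨C, hC, hb⟩ := h
  have hpos : 0 < ‖μ‖ := hr.trans_lt hμ
  have hlim : Tendsto (fun n : ℕ => C * (r / ‖μ‖) ^ n) atTop (𝓝 0) := by
    simpa using (tendsto_pow_atTop_nhds_zero_of_lt_one (by positivity)
      ((div_lt_one hpos).2 hμ)).const_mul C
  obtain ⟨n, hn⟩ := (hlim.eventually_lt_const zero_lt_one).exists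
  rw [div_pow, mul_div_assoc', div_lt_one (pow_pos hpos n)] at hn
  -- The bound makes the norm of the `n`-th power less than `‖μ‖ ^ n`.
  intro hmem
  refine absurd ((norm_pow_le_of_mem_spectrum hmem n).trans ?_) (not_le.2 hn)
  refine ContinuousLinearMap.opNorm_le_bound _ (by positivity) fun f => ?_
  refine (ContinuousMap.norm_le _ (by positivity)).2 fun x => ?_
  rw [opOn, op_pow_apply, norm_mul]
  refine mul_le_mul ?_ (f.norm_coe_le_norm _) (norm_nonneg _) (by positivity)
  exact (congrArg norm (cocycle_restrict w (mapsTo_M φ hφ) n x)).trans_le (hb x x.2 n)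

theorem exists_cocycleBoundOnM_of_op [T2Space K] {w : C(K, ℂ)} {φ : C(K, K)}
    (hφ : Function.Injective φ) {μ : ℂ} (hμ : μ ≠ 0) (h : μ ∉ spectrum ℂ (op w φ)) :
    ∃ r, 0 ≤ r ∧ r < ‖μ‖ ∧ CocycleBoundOnM w φ r := by
  obtain ⟨ν, hν, hνμ, hs⟩ := exists_notMem_spectrum_norm_lt hμ h
  obtain ⟨C, hC, hb⟩ := exists_cocycle_bound_compl_L hφ w hν hs
  exact ⟨‖ν‖, norm_nonneg ν, hνμ, cocycleBoundOnM_of_compl_L hC hb⟩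

theorem exists_cocycleBoundOnM_of_opOn [T2Space K] {w : C(K, ℂ)} {φ : C(K, K)}
    (hφ : Function.Injective φ) {μ : ℂ} (hμ : μ ≠ 0)
    (h : μ ∉ spectrum ℂ (opOn w φ (M φ) (mapsTo_M φ hφ))) :
    ∃ r, 0 ≤ r ∧ r < ‖μ‖ ∧ CocycleBoundOnM w φ r := by
  obtain ⟨ν, hν, hνμ, hs⟩ := exists_notMem_spectrum_norm_lt hμ h
  -- The growth bound is applied to the system restricted to `M`, whose own `L` is contained in `L
  -- φ`.
  obtain ⟨C, hC, hb⟩ := exists_cocycle_bound_compl_L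
    ((mapsTo_M φ hφ).restrict_inj.2 hφ.injOn) _ hν hs
  refine ⟨‖ν‖, norm_nonneg ν, hνμ, cocycleBoundOnM_of_compl_L hC fun x hx n => ?_⟩
  have hxM : x ∈ M φ := fun hx' => hx (interior_subset hx')
  refine (congrArg norm (cocycle_restrict w (mapsTo_M φ hφ) n ⟨x, hxM⟩)).symm.trans_le
    (hb ⟨x, hxM⟩ (fun hL => hx (Set.mem_iInter.2 fun m => ?_)) n)
  obtain ⟨y, hy⟩ := Set.mem_iInter.1 hL m
  exact ⟨y, (iterate_restrict_coe (mapsTo_M φ hφ) m y).symm.trans (congrArg Subtype.val hy)⟩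

theorem zero_mem_spectrum_opOn_M [T2Space K] {φ : C(K, K)} (hφ : Function.Injective φ)
    (w : C(K, ℂ)) {x : K} (hx : x ∉ Set.range φ) :
    0 ∈ spectrum ℂ (opOn w φ (M φ) (mapsTo_M φ hφ)) := by
  have hxM : x ∈ M φ := fun hx' => notMem_L_of_notMem_range hx (interior_subset hx')
  refine zero_mem_spectrum_op (x := ⟨x, hxM⟩) _ ?_
  rintro ⟨y, hy⟩
  exact hx ⟨y, congrArg Subtype.val hy⟩

theorem notMem_spectrum_iff_bijective {E : Type*} [NormedAddCommGroup E] [NormedSpace ℂ E]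
    [CompleteSpace E] {T : E →L[ℂ] E} {μ : ℂ} :
    μ ∉ spectrum ℂ T ↔ (∀ f, T f = μ • f → f = 0) ∧ ∀ f, ∃ g, μ • g - T g = f := by
  rw [spectrum.notMem_iff, ContinuousLinearMap.isUnit_iff_bijective]
  refine and_congr ?_ Iff.rfl
  rw [injective_iff_map_eq_zero]
  refine forall_congr' fun f => ?_
  rw [_root_.sub_apply, ContinuousLinearMap.algebraMap_apply, sub_eq_zero, eq_comm]

/-! ### Gluing solutions over `L` and `M` -/

variable [T2Space K]

theorem isClosed_L (φ : C(K, K)) : IsClosed (L φ) :=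
  isClosed_iInter fun n => (isCompact_range (φ.continuous.iterate n)).isClosed

/-- Solutions of the resolvent equation on `L` and on `M` agree on `L ∩ M`. -/
theorem CocycleBoundOnM.eq_of_resolvent_eq {w : C(K, ℂ)} {φ : C(K, K)}
    (hφ : Function.Injective φ) {r : ℝ} (h : CocycleBoundOnM w φ r) (hr : 0 ≤ r) {μ : ℂ}
    (hμ : r < ‖μ‖) {F : K → ℂ} {f : C(L φ, ℂ)} {g : C(M φ, ℂ)}
    (hf : ∀ x, (μ • f - opOn w φ (L φ) (mapsTo_L φ) f) x = F x)
    (hg : ∀ x, (μ • g - opOn w φ (M φ) (mapsTo_M φ hφ) g) x = F x)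
    (x : K) (hx : x ∈ L φ) (hx' : x ∈ M φ) : f ⟨x, hx⟩ = g ⟨x, hx'⟩ := by
  have hL : ∀ k, φ^[k] x ∈ L φ := fun k => (mapsTo_L φ).iterate k hx
  have hM : ∀ k, φ^[k] x ∈ M φ := fun k => (mapsTo_M φ hφ).iterate k hx'
  -- The difference of the two solutions along the orbit is bounded and solves the homogeneous
  -- equation.
  have := h.eq_zero hr hμ hx' (d := fun k => f ⟨_, hL k⟩ - g ⟨_, hM k⟩) (D := ‖f‖ + ‖g‖)
    (fun k => ?_) fun k => (norm_sub_le _ _).trans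
      (add_le_add (f.norm_coe_le_norm _) (g.norm_coe_le_norm _))
  · exact sub_eq_zero.1 this
  · have h1 := hf ⟨_, hL k⟩
    have h2 := hg ⟨_, hM k⟩
    simp only [ContinuousMap.sub_apply, ContinuousMap.smul_apply, opOn_apply, smul_eq_mul,
      ← Function.iterate_succ_apply' (φ : K → K)] at h1 h2
    linear_combination h2 - h1

/-- An eigenfunction on `L` extends by zero over `M` to one on `K`; for surjectivity, extend the
right-hand side by Tietze, solve on `K` and restrict. -/
theorem notMem_spectrum_opOn_L {w : C(K, ℂ)} {φ : C(K, K)} (hφ : Function.Injective φ)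
    {r : ℝ} (h : CocycleBoundOnM w φ r) (hr : 0 ≤ r) {μ : ℂ} (hμ : r < ‖μ‖)
    (hs : μ ∉ spectrum ℂ (op w φ)) :
    μ ∉ spectrum ℂ (opOn w φ (L φ) (mapsTo_L φ)) := by
  obtain ⟨hinj, hsurj⟩ := notMem_spectrum_iff_bijective.1 hs
  refine notMem_spectrum_iff_bijective.2 ⟨fun f hf => ?_, fun f => ?_⟩
  · obtain ⟨F, hFL, hFM⟩ := exists_glue (isClosed_L φ) (isClosed_M φ) (L_union_M φ) f 0
      (h.eq_of_resolvent_eq hφ hr hμ (F := 0) (fun x => by simp [hf]) (fun x => by simp))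
    have hF : F = 0 := by
      refine hinj F (ContinuousMap.ext fun x => ?_)
      rcases (Set.mem_union _ _ _).1 (L_union_M φ ▸ Set.mem_univ x) with hx | hx
      · have := congrArg (fun g : C(L φ, ℂ) => g ⟨x, hx⟩) hf
        simp only [opOn_apply, ContinuousMap.smul_apply] at this
        rw [op_apply, ContinuousMap.smul_apply, hFL ⟨x, hx⟩, hFL ⟨φ x, mapsTo_L φ hx⟩, this]
      · rw [op_apply, ContinuousMap.smul_apply, hFM ⟨x, hx⟩, hFM ⟨φ x, mapsTo_M φ hφ hx⟩]
        simp
    ext x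
    rw [← hFL x, hF]
    rfl
  · obtain ⟨F, rfl⟩ := ContinuousMap.exists_restrict_eq (isClosed_L φ) f
    obtain ⟨G, rfl⟩ := hsurj F
    exact ⟨G.restrict (L φ), rfl⟩

theorem notMem_spectrum_op {w : C(K, ℂ)} {φ : C(K, K)} (hφ : Function.Injective φ)
    {r : ℝ} (h : CocycleBoundOnM w φ r) (hr : 0 ≤ r) {μ : ℂ} (hμ : r < ‖μ‖)
    (hM : μ ∉ spectrum ℂ (opOn w φ (M φ) (mapsTo_M φ hφ)))
    (hL : μ ∉ spectrum ℂ (opOn w φ (L φ) (mapsTo_L φ))) :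
    μ ∉ spectrum ℂ (op w φ) := by
  obtain ⟨hinjM, hsurjM⟩ := notMem_spectrum_iff_bijective.1 hM
  obtain ⟨hinjL, hsurjL⟩ := notMem_spectrum_iff_bijective.1 hL
  refine notMem_spectrum_iff_bijective.2 ⟨fun f hf => ?_, fun f => ?_⟩
  · have hfx : ∀ x, w x * f (φ x) = μ • f x := fun x => congrArg (fun g : C(K, ℂ) => g x) hf
    have h1 := hinjL (f.restrict (L φ)) (ContinuousMap.ext fun x => hfx x)
    have h2 := hinjM (f.restrict (M φ)) (ContinuousMap.ext fun x => hfx x)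
    ext x
    rcases (Set.mem_union _ _ _).1 (L_union_M φ ▸ Set.mem_univ x) with hx | hx
    · exact congrArg (fun g : C(L φ, ℂ) => g ⟨x, hx⟩) h1
    · exact congrArg (fun g : C(M φ, ℂ) => g ⟨x, hx⟩) h2
  · obtain ⟨gL, hgL⟩ := hsurjL (f.restrict (L φ))
    obtain ⟨gM, hgM⟩ := hsurjM (f.restrict (M φ))
    have hL' : ∀ x, (μ • gL - opOn w φ (L φ) (mapsTo_L φ) gL) x = f x := fun x => by
      rw [hgL]; rfl
    have hM' : ∀ x, (μ • gM - opOn w φ (M φ) (mapsTo_M φ hφ) gM) x = f x := fun x => by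
      rw [hgM]; rfl
    obtain ⟨G, hGL, hGM⟩ := exists_glue (isClosed_L φ) (isClosed_M φ) (L_union_M φ) gL gM
      (h.eq_of_resolvent_eq hφ hr hμ hL' hM')
    refine ⟨G, ContinuousMap.ext fun x => ?_⟩
    rw [ContinuousMap.sub_apply, ContinuousMap.smul_apply, op_apply]
    rcases (Set.mem_union _ _ _).1 (L_union_M φ ▸ Set.mem_univ x) with hx | hx
    · rw [← hL' ⟨x, hx⟩, hGL ⟨x, hx⟩, hGL ⟨φ x, mapsTo_L φ hx⟩]
      rfl
    · rw [← hM' ⟨x, hx⟩, hGM ⟨x, hx⟩, hGM ⟨φ x, mapsTo_M φ hφ hx⟩]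
      rfl

theorem spectrum_opOn_M_eq_closedBall {φ : C(K, K)} (hφ : Function.Injective φ) (w : C(K, ℂ))
    {x : K} (hx : x ∉ Set.range φ) :
    spectrum ℂ (opOn w φ (M φ) (mapsTo_M φ hφ)) =
      Metric.closedBall (0 : ℂ) (spectralRadius ℂ (opOn w φ (M φ) (mapsTo_M φ hφ))).toReal := by
  have : Nonempty (M φ) := ⟨x, fun hx' => notMem_L_of_notMem_range hx (interior_subset hx')⟩
  obtain ⟨z, hz, hzr⟩ := spectrum.exists_nnnorm_eq_spectralRadius
    (opOn w φ (M φ) (mapsTo_M φ hφ))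
  have hrad : (spectralRadius ℂ (opOn w φ (M φ) (mapsTo_M φ hφ))).toReal = ‖z‖ := by
    rw [← hzr]; rfl
  refine Set.Subset.antisymm (fun μ hμ => ?_) fun μ hμ => ?_
  · rw [mem_closedBall_zero_iff, hrad]
    have : (‖μ‖₊ : ENNReal) ≤ ‖z‖₊ := hzr ▸ le_iSup₂ (α := ENNReal) μ hμ
    exact_mod_cast this
  · rw [mem_closedBall_zero_iff, hrad] at hμ
    by_contra hs
    -- The growth bound needs `μ ≠ 0`. It then contradicts the spectral value `z` of maximal
    -- modulus.
    have hμ0 : μ ≠ 0 := fun h0 => hs (h0 ▸ zero_mem_spectrum_opOn_M hφ w hx)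
    obtain ⟨r, hr, hrμ, hb⟩ := exists_cocycleBoundOnM_of_opOn hφ hμ0 hs
    exact hb.notMem_spectrum hφ hr (hrμ.trans_le hμ) hz

theorem spectrum_op_eq_union {φ : C(K, K)} (hφ : Function.Injective φ) (w : C(K, ℂ))
    {x : K} (hx : x ∉ Set.range φ) :
    spectrum ℂ (op w φ) = spectrum ℂ (opOn w φ (M φ) (mapsTo_M φ hφ)) ∪
      spectrum ℂ (opOn w φ (L φ) (mapsTo_L φ)) := by
  have : Nonempty (M φ) := ⟨x, fun hx' => notMem_L_of_notMem_range hx (interior_subset hx')⟩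
  ext μ
  rw [← not_iff_not, Set.mem_union, not_or]
  constructor
  · intro hs
    have hμ0 : μ ≠ 0 := fun h0 => hs (h0 ▸ zero_mem_spectrum_op w hx)
    obtain ⟨r, hr, hrμ, hb⟩ := exists_cocycleBoundOnM_of_op hφ hμ0 hs
    exact ⟨hb.notMem_spectrum hφ hr hrμ, notMem_spectrum_opOn_L hφ hb hr hrμ hs⟩
  · rintro ⟨hM, hL⟩
    have hμ0 : μ ≠ 0 := fun h0 => hM (h0 ▸ zero_mem_spectrum_opOn_M hφ w hx)
    obtain ⟨r, hr, hrμ, hb⟩ := exists_cocycleBoundOnM_of_opOn hφ hμ0 hM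
    exact notMem_spectrum_op hφ hb hr hrμ hM hL

end WeightedComposition

theorem theorem1 {K : Type*} [TopologicalSpace K] [CompactSpace K] [T2Space K]
    (φ : C(K, K)) (hφ : Topology.IsEmbedding φ) (hns : Set.range φ ⊂ Set.univ) (w : C(K, ℂ)) :
    (spectrum ℂ (WeightedComposition.opOn w φ (WeightedComposition.M φ) (WeightedComposition.mapsTo_M φ hφ.injective)) =
        Metric.closedBall (0 : ℂ)
          (spectralRadius ℂ (WeightedComposition.opOn w φ (WeightedComposition.M φ) (WeightedComposition.mapsTo_M φ hφ.injective))).toReal ∨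
      spectrum ℂ (WeightedComposition.opOn w φ (WeightedComposition.M φ) (WeightedComposition.mapsTo_M φ hφ.injective)) = {0}) ∧
    spectrum ℂ (WeightedComposition.op w φ) =
      spectrum ℂ (WeightedComposition.opOn w φ (WeightedComposition.M φ) (WeightedComposition.mapsTo_M φ hφ.injective)) ∪
        spectrum ℂ (WeightedComposition.opOn w φ (WeightedComposition.L φ) (WeightedComposition.mapsTo_L φ)) := by
  obtain ⟨x, -, hx⟩ := Set.exists_of_ssubset hns
  exact ⟨Or.inl (WeightedComposition.spectrum_opOn_M_eq_closedBall hφ.injective w hx),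
    WeightedComposition.spectrum_op_eq_union hφ.injective w hx⟩
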